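/- Let $p\ge q$ be natural numbers. Let $M(p,q)$ be the space of real $p\times q$ matrices and $P^+(q)$ the set of real symmetric positive definite $q\times q$ matrices, with their Borel $\sigma$-algebras. Let $\mathcal U\in P^+(p)$. On $P^+(q)$ consider the measure $$\mu(dS)=(\det S)^{-(q+1)/2}\prod_{1\le i\le j\le q}dS_{ij},$$ and on $M(p,q)$ the measure $$\nu_{\mathcal U}(dX)=\frac{\Gamma_q(p/2)}{\pi^{pq/2}}\,\frac{(\det\mathcal U)^{-q/2}}{\det(X^\top\mathcal U^{-1}X)^{p/2}}\,\prod_{i=1}^p\prod_{j=1}^q dX_{ij},\qquad \Gamma_q(a)=\pi^{q(q-1)/4}\prod_{i=1}^q\Gamma\Big(a-\frac{i-1}{2}\Big).$$ The density of $\nu_{\mathcal U}$ is defined where $X^\top\mathcal U^{-1}X$ is positive definite, which holds outside a Lebesgue null set. Let $\tilde\pi:P^+(q)\to[0,\infty]$ be measurable and such that $\tilde\Pi(dS)=\tilde\pi(S)\,\mu(dS)$ is a probability measure on $P^+(q)$. Define $$\Pi(dx)=\tilde\pi(x^\top\mathcal U^{-1}x)\,\nu_{\mathcal U}(dx)\quad\text{on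 } M(p,q).$$ Then $\Pi$ is a probability measure on $M(p,q)$, and if $X$ is a random matrix with law $\Pi$, then $X^\top\mathcal U^{-1}X$ is almost surely in $P^+(q)$ and $S=X^\top\mathcal U^{-1}X$ has law $\tilde\Pi$. -/

import Mathlib

open MeasureTheory ProbabilityTheory
open scoped ENNReal Matrix

namespace Upcast

noncomputable section

/-- The (Borel) σ-algebra on real `m × n` matrices generated by the entries. -/
instance instMeasurableSpaceMatrix {m n : Type*} : MeasurableSpace (Matrix m n ℝ) :=
  inferInstanceAs (MeasurableSpace (m → n → ℝ))

/-- Lebesgue measure `∏ᵢ ∏ⱼ dXᵢⱼ` on the space `M(p,q)` of real `p × q` matrices. -/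
def lebMatrix (p q : ℕ) : Measure (Matrix (Fin p) (Fin q) ℝ) :=
  (volume : Measure (Fin p → Fin q → ℝ))

/-- `P⁺(q)`: symmetric positive definite real `q × q` matrices, with the σ-algebra induced
from `M(q,q)`. -/
abbrev PosDefMatrix (q : ℕ) : Type := {S : Matrix (Fin q) (Fin q) ℝ // S.PosDef}

/-- The multivariate Gamma function
`Γ_q(a) = π^{q(q-1)/4} ∏_{i=1}^{q} Γ(a - (i-1)/2)`. -/
def multiGamma (q : ℕ) (a : ℝ) : ℝ :=
  Real.pi ^ ((q : ℝ) * ((q : ℝ) - 1) / 4) * ∏ i : Fin q, Real.Gamma (a - ((i : ℕ) : ℝ) / 2)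

/-- The quadratic map `x ↦ xᵀ U⁻¹ x` from `M(p,q)` to `M(q,q)`. -/
def gram {p q : ℕ} (U : Matrix (Fin p) (Fin p) ℝ) (x : Matrix (Fin p) (Fin q) ℝ) :
    Matrix (Fin q) (Fin q) ℝ :=
  xᵀ * U⁻¹ * x

/-- The reference measure `ν_U` on `M(p,q)`:
`ν_U(dX) = Γ_q(p/2) / π^{pq/2} · (det U)^{-q/2} / det(Xᵀ U⁻¹ X)^{p/2} Leb(dX)`. -/
def nu {p : ℕ} (q : ℕ) (U : Matrix (Fin p) (Fin p) ℝ) : Measure (Matrix (Fin p) (Fin q) ℝ) :=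
  (lebMatrix p q).withDensity fun X => ENNReal.ofReal
    (multiGamma q ((p : ℝ) / 2) / Real.pi ^ ((p : ℝ) * (q : ℝ) / 2) *
      (U.det ^ (-(q : ℝ) / 2) / (gram U X).det ^ ((p : ℝ) / 2)))

/-- The upper triangular entries `(Sᵢⱼ)_{i ≤ j}` of a positive definite matrix, used as
coordinates on `P⁺(q)`. -/
def upperCoords (q : ℕ) (S : PosDefMatrix q) : {ij : Fin q × Fin q // ij.1 ≤ ij.2} → ℝ :=
  fun ij => S.1 ij.1.1 ij.1.2

/-- Lebesgue measure `∏_{i ≤ j} dSᵢⱼ` on `P⁺(q)`: the measure of a set is the Lebesgue measure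
of its image under `upperCoords` (see `measurableEmbedding_upperCoords`). -/
def lebPosDef (q : ℕ) : Measure (PosDefMatrix q) :=
  Measure.comap (upperCoords q) volume

/-- The reference measure `μ(dS) = (det S)^{-(q+1)/2} ∏_{i ≤ j} dSᵢⱼ` on `P⁺(q)`. -/
def mu (q : ℕ) : Measure (PosDefMatrix q) :=
  (lebPosDef q).withDensity fun S => ENNReal.ofReal (S.1.det ^ (-((q : ℝ) + 1) / 2))

/-- The measure `π̃(S) μ(dS)` on `P⁺(q)`. -/
def targetLaw {q : ℕ} (f : PosDefMatrix q → ℝ≥0∞) : Measure (PosDefMatrix q) :=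
  (mu q).withDensity f

open scoped Classical in
/-- The function `x ↦ π̃(xᵀ U⁻¹ x)` on `M(p,q)`. As `π̃` lives on `P⁺(q)` only, it is given the
value `0` at the matrices `x` for which `xᵀ U⁻¹ x` is not positive definite; for `U` positive
definite and `q ≤ p` these are the `x` of rank `< q`, a set of Lebesgue measure zero. -/
def upcastDensity {p q : ℕ} (U : Matrix (Fin p) (Fin p) ℝ) (f : PosDefMatrix q → ℝ≥0∞)
    (x : Matrix (Fin p) (Fin q) ℝ) : ℝ≥0∞ :=
  if h : (gram U x).PosDef then f ⟨gram U x, h⟩ else 0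

/-- The upcast measure `Π(dx) = π̃(xᵀ U⁻¹ x) ν_U(dx)` on `M(p,q)`. -/
def upcastLaw {p q : ℕ} (U : Matrix (Fin p) (Fin p) ℝ) (f : PosDefMatrix q → ℝ≥0∞) :
    Measure (Matrix (Fin p) (Fin q) ℝ) :=
  (nu q U).withDensity (upcastDensity U f)

theorem measurable_entry {m n : Type*} (i : m) (j : n) :
    Measurable fun A : Matrix m n ℝ => A i j :=
  (measurable_pi_apply j).comp (measurable_pi_apply (X := fun _ : m => n → ℝ) i)

theorem measurableSet_posDef (q : ℕ) :
    MeasurableSet {S : Matrix (Fin q) (Fin q) ℝ | S.PosDef} := by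
  have hb : BorelSpace (Matrix (Fin q) (Fin q) ℝ) :=
    inferInstanceAs (BorelSpace (Fin q → Fin q → ℝ))
  have h1 : IsClosed {S : Matrix (Fin q) (Fin q) ℝ | S.PosSemidef} := by
    have : {S : Matrix (Fin q) (Fin q) ℝ | S.PosSemidef} =
        {S | Sᴴ = S} ∩ ⋂ x : Fin q → ℝ, {S | 0 ≤ star x ⬝ᵥ (S *ᵥ x)} := by
      ext S
      simp [Matrix.posSemidef_iff_dotProduct_mulVec, Matrix.IsHermitian]
    rw [this]
    refine (isClosed_eq (by fun_prop) continuous_id).inter (isClosed_iInter fun x => ?_)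
    exact isClosed_le continuous_const (by fun_prop)
  have h2 : IsOpen {S : Matrix (Fin q) (Fin q) ℝ | S.det ≠ 0} :=
    isOpen_ne_fun (by fun_prop) continuous_const
  have h3 : {S : Matrix (Fin q) (Fin q) ℝ | S.PosDef} = {S | S.PosSemidef} ∩ {S | S.det ≠ 0} := by
    ext S
    constructor
    · intro h
      exact ⟨h.posSemidef, h.det_pos.ne'⟩
    · rintro ⟨h, h'⟩
      exact h.posDef_iff_isUnit.2 ((Matrix.isUnit_iff_isUnit_det S).2 (isUnit_iff_ne_zero.2 h'))
  rw [h3]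
  exact h1.measurableSet.inter h2.measurableSet

/-- The symmetric matrix with prescribed upper triangular entries. -/
def symmOfUpper (q : ℕ) (v : {ij : Fin q × Fin q // ij.1 ≤ ij.2} → ℝ) :
    Matrix (Fin q) (Fin q) ℝ :=
  fun i j => v ⟨(min i j, max i j), min_le_max⟩

theorem measurable_symmOfUpper (q : ℕ) : Measurable (symmOfUpper q) :=
  measurable_pi_lambda (X := fun _ : Fin q => Fin q → ℝ) _ fun _ =>
    measurable_pi_lambda _ fun _ => measurable_pi_apply _

theorem symmOfUpper_upperCoords (q : ℕ) (S : PosDefMatrix q) :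
    symmOfUpper q (upperCoords q S) = S.1 := by
  ext i j
  rcases le_total i j with h | h
  · simp [symmOfUpper, upperCoords, h]
  · have := S.2.isHermitian.apply i j
    simp only [star_trivial] at this
    simp [symmOfUpper, upperCoords, h, this]

/-- `upperCoords` identifies `P⁺(q)` with a Borel subset of `ℝ^{q(q+1)/2}`, so that `lebPosDef`
is the Lebesgue measure in these coordinates. -/
theorem measurableEmbedding_upperCoords (q : ℕ) : MeasurableEmbedding (upperCoords q) := by
  classical
  have hm : MeasurableSet {v | (symmOfUpper q v).PosDef} :=
    measurable_symmOfUpper q (measurableSet_posDef q)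
  have hr : Set.range (upperCoords q) = {v | (symmOfUpper q v).PosDef} := by
    ext v
    constructor
    · rintro ⟨S, rfl⟩
      change (symmOfUpper q (upperCoords q S)).PosDef
      rw [symmOfUpper_upperCoords]; exact S.2
    · intro h
      refine ⟨⟨symmOfUpper q v, h⟩, ?_⟩
      ext ⟨⟨i, j⟩, hij⟩
      have hij' : i ≤ j := hij
      simp [upperCoords, symmOfUpper, hij']
  let T : Set ({ij : Fin q × Fin q // ij.1 ≤ ij.2} → ℝ) := {v | (symmOfUpper q v).PosDef}
  let g₀ : T → PosDefMatrix q := fun v => ⟨symmOfUpper q v.1, v.2⟩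
  have hg₀ : Measurable g₀ :=
    ((measurable_symmOfUpper q).comp measurable_subtype_coe).subtype_mk
  let g : ({ij : Fin q × Fin q // ij.1 ≤ ij.2} → ℝ) → PosDefMatrix q :=
    fun v => if h : v ∈ T then g₀ ⟨v, h⟩ else ⟨1, Matrix.PosDef.one⟩
  have hg : Measurable g := Measurable.dite hg₀ measurable_const hm
  refine MeasurableEmbedding.of_measurable_inverse (g := g) ?_ (hr ▸ hm) hg ?_
  · exact measurable_pi_lambda _ fun ij => (measurable_entry _ _).comp measurable_subtype_coe
  · intro S
    have h : upperCoords q S ∈ T := by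
      change (symmOfUpper q (upperCoords q S)).PosDef
      rw [symmOfUpper_upperCoords]; exact S.2
    simp only [g, dif_pos h, g₀]
    exact Subtype.ext (symmOfUpper_upperCoords q S)

end

end Upcast

/-! The theorem reduces to a formula for Lebesgue measure under the Gram map: if `q` vectors in
`ℝ^p` are integrated freely, their Gram matrix `S` has density `π^{pq/2} / Γ_q(p/2) · (det
S)^{(p-q-1)/2}` on `P⁺(q)` (`lintegral_rowGram`).

The proof is by induction on `q`. Rotate the first vector `x` onto the first axis
(`lintegral_dotProduct_rowGram`) and split the others into first coordinates `b` and remainders `Y`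
in one dimension less. With `a = |x|²`, the Gram matrix has corner `a`, border `√a b` and block `b
bᵀ + Gram Y`, so its Schur complement is `Gram Y`, to which induction applies. Rescaling `b`,
translating the block and using `det = a · det(Schur complement)` recovers the density
(`lintegral_detPow_bordered`); polar coordinates supply the law of `a` and the new Gamma factor.

Writing `U⁻¹ = Vᵀ V` adds the Jacobian `(det U)^{q/2}` (`lintegral_gram`). The density of `ν_U`
cancels all constants and turns the exponent into `-(q+1)/2`, that of `μ` (`lintegral_upcastLaw`).
-/

namespace Upcast

/-! ### Bordered matrices -/

/-- The matrix with corner `a`, first row and first column continued by `b`, and remaining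
block `C`. -/
def bordered {q : ℕ} (a : ℝ) (b : Fin q → ℝ) (C : Matrix (Fin q) (Fin q) ℝ) :
    Matrix (Fin (q + 1)) (Fin (q + 1)) ℝ :=
  Matrix.of (Fin.cons (Fin.cons a b) fun i => Fin.cons (b i) (C i))

section bordered

variable {q : ℕ} (a : ℝ) (b : Fin q → ℝ) (C : Matrix (Fin q) (Fin q) ℝ)

@[simp] theorem bordered_zero_zero : bordered a b C 0 0 = a := rfl

@[simp] theorem bordered_zero_succ (j : Fin q) : bordered a b C 0 j.succ = b j := rfl

@[simp] theorem bordered_succ_zero (i : Fin q) : bordered a b C i.succ 0 = b i := rfl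

@[simp] theorem bordered_succ_succ (i j : Fin q) : bordered a b C i.succ j.succ = C i j := rfl

/-- The unipotent lower triangular matrix with first column `(1, c)`. -/
def borderedUnipotent (c : Fin q → ℝ) : Matrix (Fin (q + 1)) (Fin (q + 1)) ℝ :=
  Matrix.of (Fin.cons (Fin.cons 1 0) fun i => Fin.cons (c i) ((1 : Matrix (Fin q) (Fin q) ℝ) i))

theorem det_borderedUnipotent (c : Fin q → ℝ) : (borderedUnipotent c).det = 1 := by
  rw [Matrix.det_succ_row_zero, Fin.sum_univ_succ]
  have : (borderedUnipotent c).submatrix Fin.succ Fin.succ = 1 := rfl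
  simp [borderedUnipotent] at this ⊢
  simp [this]

theorem det_bordered_zero : (bordered a 0 C).det = a * C.det := by
  rw [Matrix.det_succ_row_zero, Fin.sum_univ_succ]
  have : (bordered a 0 C).submatrix Fin.succ Fin.succ = C := rfl
  simp [this]

/-- One step of symmetric Gaussian elimination: `C` is the Schur complement of the corner `a`.
Positivity and determinant of a bordered matrix are both read off from this congruence. -/
theorem bordered_eq_conj (ha : a ≠ 0) :
    bordered a b (C + a⁻¹ • Matrix.vecMulVec b b) =
      borderedUnipotent (a⁻¹ • b) * bordered a 0 C * star (borderedUnipotent (a⁻¹ • b)) := by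
  ext i j
  rw [Matrix.mul_apply, Fin.sum_univ_succ]
  simp only [Matrix.mul_apply, Fin.sum_univ_succ, Matrix.star_apply, star_trivial]
  refine Fin.cases ?_ (fun i => ?_) i <;> refine Fin.cases ?_ (fun j => ?_) j <;>
    simp [borderedUnipotent, Matrix.vecMulVec_apply, Matrix.one_apply]
  · field_simp
  · field_simp
  · field_simp
    ring

theorem posDef_bordered_zero_iff : (bordered a 0 C).PosDef ↔ 0 < a ∧ C.PosDef := by
  simp only [Matrix.posDef_iff_dotProduct_mulVec]
  have key : ∀ x : Fin (q + 1) → ℝ, star x ⬝ᵥ (bordered a 0 C) *ᵥ x =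
      x 0 * (a * x 0) + star (Fin.tail x) ⬝ᵥ C *ᵥ Fin.tail x := by
    intro x
    simp [dotProduct, Matrix.mulVec, Fin.sum_univ_succ, Fin.tail]
  constructor
  · rintro ⟨h1, h2⟩
    refine ⟨?_, ?_, fun x hx => ?_⟩
    · have := h2 (x := Fin.cons 1 0) (fun h => one_ne_zero (congrFun h 0))
      rw [key] at this
      simpa using this
    · ext i j
      simpa using h1.apply i.succ j.succ
    · have := h2 (x := Fin.cons 0 x) (fun h => hx (by
        ext i; simpa using congrFun h i.succ))
      rw [key] at this
      simpa using this
  · rintro ⟨ha, h1, h2⟩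
    refine ⟨?_, fun x hx => ?_⟩
    · ext i j
      have := fun i j => h1.apply i j
      refine Fin.cases ?_ (fun i => ?_) i <;> refine Fin.cases ?_ (fun j => ?_) j <;>
        simp_all
    · rw [key]
      by_cases ht : Fin.tail x = 0
      · have h0 : x 0 ≠ 0 := fun h0 => hx (by
          ext i
          refine Fin.cases h0 (fun i => congrFun ht i) i)
        rw [ht]
        have : 0 < x 0 * x 0 := mul_self_pos.2 h0
        have := mul_pos ha this
        simp
        linarith
      · have := h2 ht
        have := mul_nonneg ha.le (mul_self_nonneg (x 0))
        linarith

theorem posDef_bordered_iff (ha : 0 < a) :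
    (bordered a b C).PosDef ↔ (C - a⁻¹ • Matrix.vecMulVec b b).PosDef := by
  have hu : IsUnit (borderedUnipotent (a⁻¹ • b)) := by
    rw [Matrix.isUnit_iff_isUnit_det, det_borderedUnipotent]; exact isUnit_one
  have h := bordered_eq_conj a b (C - a⁻¹ • Matrix.vecMulVec b b) ha.ne'
  rw [sub_add_cancel] at h
  rw [h, Matrix.IsUnit.posDef_star_right_conjugate_iff hu, posDef_bordered_zero_iff]
  exact and_iff_right ha

theorem det_bordered (ha : a ≠ 0) :
    (bordered a b C).det = a * (C - a⁻¹ • Matrix.vecMulVec b b).det := by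
  have h := bordered_eq_conj a b (C - a⁻¹ • Matrix.vecMulVec b b) ha
  rw [sub_add_cancel] at h
  rw [h, Matrix.det_mul, Matrix.det_mul, Matrix.star_eq_conjTranspose, Matrix.det_conjTranspose,
    det_borderedUnipotent, det_bordered_zero]
  simp

variable {a b C} in
theorem pos_of_posDef_bordered (h : (bordered a b C).PosDef) : 0 < a := by
  simpa using h.diag_pos (i := 0)

end bordered

open scoped Classical in
/-- The function equal to `(det S) ^ e` on positive definite `S` and to `0` elsewhere. -/
noncomputable def detPow (q : ℕ) (e : ℝ) (S : Matrix (Fin q) (Fin q) ℝ) : ℝ≥0∞ :=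
  if S.PosDef then ENNReal.ofReal (S.det ^ e) else 0

/-- Since `detPow` vanishes off the positive definite cone, the Schur complement factorization needs
no condition on `b` or `C` and can be used under the integral sign. -/
theorem detPow_bordered {q : ℕ} (e : ℝ) {a : ℝ} (ha : 0 < a) (b : Fin q → ℝ)
    (C : Matrix (Fin q) (Fin q) ℝ) :
    detPow (q + 1) e (bordered a b C) =
      ENNReal.ofReal (a ^ e) * detPow q e (C - a⁻¹ • Matrix.vecMulVec b b) := by
  unfold detPow
  rw [posDef_bordered_iff a b C ha]
  split_ifs with h
  · rw [det_bordered a b C ha.ne', Real.mul_rpow ha.le h.det_pos.le,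
      ENNReal.ofReal_mul (Real.rpow_nonneg ha.le e)]
  · simp

theorem detPow_bordered_of_nonpos {q : ℕ} (e : ℝ) {a : ℝ} (ha : a ≤ 0) (b : Fin q → ℝ)
    (C : Matrix (Fin q) (Fin q) ℝ) : detPow (q + 1) e (bordered a b C) = 0 :=
  if_neg fun h => (pos_of_posDef_bordered h).not_ge ha

/-! ### Measurability -/

theorem measurable_matrix_iff {α m n : Type*} [MeasurableSpace α] {A : α → Matrix m n ℝ} :
    Measurable A ↔ ∀ i j, Measurable fun x => A x i j :=
  ⟨fun h i j => (measurable_entry i j).comp h, fun h =>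
    measurable_pi_lambda (X := fun _ : m => n → ℝ) _ fun i => measurable_pi_lambda _ fun j => h i j⟩

theorem measurable_det (q : ℕ) : Measurable fun S : Matrix (Fin q) (Fin q) ℝ => S.det := by
  simp only [Matrix.det_apply]
  exact Finset.measurable_sum _ fun σ _ =>
    (Finset.measurable_prod _ fun i _ => measurable_entry _ _).const_smul _

@[fun_prop]
theorem measurable_detPow (q : ℕ) (e : ℝ) : Measurable (detPow q e) :=
  Measurable.ite (measurableSet_posDef q)
    ((measurable_det q).pow_const e).ennreal_ofReal measurable_const

@[fun_prop]
theorem measurable_bordered {α : Type*} [MeasurableSpace α] {q : ℕ} {a : α → ℝ}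
    {b : α → Fin q → ℝ} {C : α → Matrix (Fin q) (Fin q) ℝ} (ha : Measurable a) (hb : Measurable b)
    (hC : Measurable C) : Measurable fun x => bordered (a x) (b x) (C x) := by
  rw [measurable_matrix_iff] at hC ⊢
  intro i j
  refine Fin.cases ?_ (fun i => ?_) i <;> refine Fin.cases ?_ (fun j => ?_) j <;> simp
  · exact ha
  · exact (measurable_pi_apply _).comp hb
  · exact (measurable_pi_apply _).comp hb
  · exact hC i j

/-- The matrix of inner products of a family of vectors. -/
def rowGram {p q : ℕ} (Z : Fin q → Fin p → ℝ) : Matrix (Fin q) (Fin q) ℝ :=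
  Matrix.of fun i j => Z i ⬝ᵥ Z j

@[fun_prop]
theorem measurable_rowGram {p q : ℕ} : Measurable (rowGram (p := p) (q := q)) := by
  rw [measurable_matrix_iff]
  intro i j
  simp only [rowGram, Matrix.of_apply, dotProduct]
  fun_prop

theorem rowGram_cons {p q : ℕ} (x : Fin p → ℝ) (Y : Fin q → Fin p → ℝ) :
    rowGram (Fin.cons x Y : Fin (q + 1) → Fin p → ℝ) =
      bordered (x ⬝ᵥ x) (fun i => x ⬝ᵥ Y i) (rowGram Y) := by
  ext i j
  refine Fin.cases ?_ (fun i => ?_) i <;> refine Fin.cases ?_ (fun j => ?_) j <;>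
    simp [rowGram, dotProduct_comm]

theorem rowGram_rows_cons {p q : ℕ} (b : Fin q → ℝ) (Y : Fin q → Fin p → ℝ) :
    rowGram (fun i => (Fin.cons (b i) (Y i) : Fin (p + 1) → ℝ)) =
      Matrix.vecMulVec b b + rowGram Y := by
  ext i j
  simp [rowGram, dotProduct, Fin.sum_univ_succ, Matrix.vecMulVec_apply]

/-! ### Fubini in matrix coordinates -/

theorem piFinSuccAbove_zero_symm_apply {E : Type*} [MeasurableSpace E] {n : ℕ}
    (w : E × (Fin n → E)) :
    (MeasurableEquiv.piFinSuccAbove (fun _ : Fin (n + 1) => E) 0).symm w = Fin.cons w.1 w.2 :=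
  Fin.insertNth_zero' w.1 w.2

theorem lintegral_finCons {E : Type*} [MeasureSpace E] [SigmaFinite (volume : Measure E)] {n : ℕ}
    {F : (Fin (n + 1) → E) → ℝ≥0∞} (hF : Measurable F) :
    ∫⁻ Z, F Z = ∫⁻ x, ∫⁻ Y : Fin n → E, F (Fin.cons x Y) := by
  have h := (volume_preserving_piFinSuccAbove (fun _ : Fin (n + 1) => E) 0).symm
  rw [← h.lintegral_comp hF, Measure.volume_eq_prod, lintegral_prod]
  · simp only [piFinSuccAbove_zero_symm_apply]
  · exact (hF.comp h.measurable).aemeasurable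

/-- Whereas `lintegral_finCons` removes one vector from the family, this removes the first
coordinate of every vector. -/
theorem lintegral_rows_finCons {p q : ℕ} {F : (Fin q → Fin (p + 1) → ℝ) → ℝ≥0∞}
    (hF : Measurable F) :
    ∫⁻ Y, F Y = ∫⁻ b : Fin q → ℝ, ∫⁻ Y : Fin q → Fin p → ℝ, F fun i => Fin.cons (b i) (Y i) := by
  have h := (volume_preserving_pi fun _ : Fin q =>
    (volume_preserving_piFinSuccAbove (fun _ : Fin (p + 1) => ℝ) 0).symm).comp
    (volume_measurePreserving_arrowProdEquivProdArrow ℝ (Fin p → ℝ) (Fin q)).symm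
  rw [← h.lintegral_comp hF, Measure.volume_eq_prod, lintegral_prod]
  · simp only [Function.comp_def, piFinSuccAbove_zero_symm_apply]
    rfl
  · exact (hF.comp h.measurable).aemeasurable

/-- The index set of the entries on and above the diagonal. -/
abbrev UpperIndex (q : ℕ) : Type := {ij : Fin q × Fin q // ij.1 ≤ ij.2}

/-- Splits the upper triangle into its first row and the rest. -/
def upperIndexSucc (q : ℕ) : Fin (q + 1) ⊕ UpperIndex q → UpperIndex (q + 1) :=
  Sum.elim (fun j => ⟨(0, j), Fin.zero_le j⟩)
    fun ij => ⟨(ij.1.1.succ, ij.1.2.succ), Fin.succ_le_succ_iff.2 ij.2⟩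

theorem bijective_upperIndexSucc (q : ℕ) : Function.Bijective (upperIndexSucc q) := by
  constructor
  · rintro (i | ⟨⟨i, j⟩, h⟩) (i' | ⟨⟨i', j'⟩, h'⟩) hh <;>
      simp_all [upperIndexSucc, Fin.succ_ne_zero, (Fin.succ_ne_zero _).symm]
  · rintro ⟨⟨i, j⟩, h⟩
    induction i using Fin.cases with
    | zero => exact ⟨Sum.inl j, rfl⟩
    | succ i =>
      induction j using Fin.cases with
      | zero => exact absurd h (by simp)
      | succ j => exact ⟨Sum.inr ⟨(i, j), Fin.succ_le_succ_iff.1 h⟩, rfl⟩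

theorem symmOfUpper_eq_bordered (q : ℕ) (v : UpperIndex (q + 1) → ℝ) :
    symmOfUpper (q + 1) v =
      bordered (v (upperIndexSucc q (.inl 0))) (fun j => v (upperIndexSucc q (.inl j.succ)))
        (symmOfUpper q fun ij => v (upperIndexSucc q (.inr ij))) := by
  ext i j
  refine Fin.cases ?_ (fun i => ?_) i <;> refine Fin.cases ?_ (fun j => ?_) j <;>
    simp [symmOfUpper, upperIndexSucc]
  -- `Fin.succ` is monotone, so it commutes with the `min` and `max` that select the upper entry.
  congr 3
  · exact (Fin.strictMono_succ.monotone.map_min).symm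
  · exact (Fin.strictMono_succ.monotone.map_max).symm

theorem lintegral_symmOfUpper_succ {q : ℕ} {F : Matrix (Fin (q + 1)) (Fin (q + 1)) ℝ → ℝ≥0∞}
    (hF : Measurable F) :
    ∫⁻ v, F (symmOfUpper (q + 1) v) =
      ∫⁻ a, ∫⁻ b, ∫⁻ v, F (bordered a b (symmOfUpper q v)) := by
  let e := Equiv.ofBijective _ (bijective_upperIndexSucc q)
  have h := (volume_measurePreserving_piCongrLeft (fun _ : UpperIndex (q + 1) => ℝ) e).comp
    (volume_measurePreserving_sumPiEquivProdPi
      (fun _ : Fin (q + 1) ⊕ UpperIndex q => ℝ)).symm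
  have key : ∀ w : (Fin (q + 1) → ℝ) × (UpperIndex q → ℝ),
      symmOfUpper (q + 1) ((MeasurableEquiv.piCongrLeft (fun _ : UpperIndex (q + 1) => ℝ) e ∘
        (MeasurableEquiv.sumPiEquivProdPi (fun _ : Fin (q + 1) ⊕ UpperIndex q => ℝ)).symm) w) =
      bordered (w.1 0) (fun j => w.1 j.succ) (symmOfUpper q w.2) := by
    intro w
    rw [symmOfUpper_eq_bordered]
    have h1 : ∀ s, (MeasurableEquiv.piCongrLeft (fun _ : UpperIndex (q + 1) => ℝ) e ∘
        (MeasurableEquiv.sumPiEquivProdPi (fun _ : Fin (q + 1) ⊕ UpperIndex q => ℝ)).symm) w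
          (upperIndexSucc q s) = Sum.elim w.1 w.2 s := by
      intro s
      change (Equiv.piCongrLeft (fun _ : UpperIndex (q + 1) => ℝ) e)
        ((Equiv.sumPiEquivProdPi (fun _ : Fin (q + 1) ⊕ UpperIndex q => ℝ)).symm w) (e s) = _
      rw [Equiv.piCongrLeft_apply_apply]
      cases s <;> rfl
    simp only [h1]
    rfl
  have hs := measurable_symmOfUpper
  rw [← h.lintegral_comp (f := fun v => F (symmOfUpper (q + 1) v)) (hF.comp (hs (q + 1)))]
  simp only [Function.comp_def] at key ⊢
  simp only [key]
  have hm : Measurable fun w : (Fin (q + 1) → ℝ) × (UpperIndex q → ℝ) =>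
      F (bordered (w.1 0) (fun j => w.1 j.succ) (symmOfUpper q w.2)) :=
    hF.comp (measurable_bordered (by fun_prop) (by fun_prop) ((hs q).comp measurable_snd))
  rw [Measure.volume_eq_prod, lintegral_prod _ hm.aemeasurable,
    lintegral_finCons hm.lintegral_prod_right']
  rfl

/-! ### Radial integration -/

/-- Polar coordinates: drop the null point `0`, identify the rest with sphere times `(0, ∞)`, and
integrate out the sphere, whose mass is the dimension times the volume of the unit ball. -/
theorem lintegral_fun_norm_addHaar {E : Type*} [NormedAddCommGroup E] [NormedSpace ℝ E]
    [Nontrivial E] [FiniteDimensional ℝ E] [MeasurableSpace E] [BorelSpace E] (μ : Measure E)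
    [μ.IsAddHaarMeasure] {f : ℝ → ℝ≥0∞} (hf : Measurable f) :
    ∫⁻ x, f ‖x‖ ∂μ = Module.finrank ℝ E * μ (Metric.ball 0 1) *
      ∫⁻ r in Set.Ioi (0 : ℝ), ENNReal.ofReal (r ^ (Module.finrank ℝ E - 1)) * f r := by
  have h1 : ∫⁻ x, f ‖x‖ ∂μ = ∫⁻ x : ({(0)}ᶜ : Set E), f ‖x.1‖ ∂(μ.comap (↑)) := by
    rw [lintegral_subtype_comap (measurableSet_singleton _).compl fun x ↦ f (‖x‖),
      restrict_compl_singleton]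
  have h2 : ∫⁻ x : ({(0)}ᶜ : Set E), f ‖x.1‖ ∂(μ.comap (↑)) =
      ∫⁻ x, f x.2 ∂μ.toSphere.prod (.volumeIoiPow (Module.finrank ℝ E - 1)) := by
    simpa using μ.measurePreserving_homeomorphUnitSphereProd.lintegral_comp_emb
      (Homeomorph.measurableEmbedding _) (f ∘ Subtype.val ∘ Prod.snd)
  have hm : Measurable fun r : Set.Ioi (0 : ℝ) => f r := hf.comp measurable_subtype_coe
  rw [h1, h2, lintegral_prod (fun x : _ × Set.Ioi (0 : ℝ) => f x.2)
    (hm.comp measurable_snd).aemeasurable]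
  dsimp only
  rw [lintegral_const, μ.toSphere_apply_univ, mul_comm, Measure.volumeIoiPow,
    lintegral_withDensity_eq_lintegral_mul _
      (measurable_subtype_coe.pow_const _).ennreal_ofReal hm]
  congr 1
  exact lintegral_subtype_comap measurableSet_Ioi
    fun r => ENNReal.ofReal (r ^ (Module.finrank ℝ E - 1)) * f r

theorem lintegral_Ioi_eq_lintegral_comp_sqrt (f : ℝ → ℝ≥0∞) :
    ∫⁻ r in Set.Ioi (0 : ℝ), f r =
      ∫⁻ a in Set.Ioi (0 : ℝ), ENNReal.ofReal (1 / (2 * √a)) * f √a := by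
  have himg : Real.sqrt '' Set.Ioi 0 = Set.Ioi 0 := by
    ext r
    constructor
    · rintro ⟨a, ha, rfl⟩
      exact Real.sqrt_pos.2 ha
    · intro hr
      exact ⟨r ^ 2, pow_pos (Set.mem_Ioi.1 hr) 2, Real.sqrt_sq (le_of_lt hr)⟩
  have h := lintegral_image_eq_lintegral_abs_deriv_mul (s := Set.Ioi 0) (f := Real.sqrt)
    (f' := fun a => 1 / (2 * √a)) measurableSet_Ioi
    (fun a ha => (Real.hasDerivAt_sqrt (ne_of_gt ha)).hasDerivWithinAt)
    (fun a ha b hb hab => (Real.sqrt_inj (le_of_lt ha) (le_of_lt hb)).1 hab) f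
  rw [himg] at h
  rw [h]
  refine lintegral_congr fun a => ?_
  rw [abs_of_nonneg (by positivity)]

/-- Polar coordinates followed by `a = r²`, under which `r^n dr` becomes `a^{(n-1)/2} da / 2`; the
constant is half the area of the unit sphere. -/
theorem lintegral_dotProduct_self (n : ℕ) {f : ℝ → ℝ≥0∞} (hf : Measurable f) :
    ∫⁻ x : Fin (n + 1) → ℝ, f (x ⬝ᵥ x) =
      ENNReal.ofReal (Real.pi ^ (((n : ℝ) + 1) / 2) / Real.Gamma (((n : ℝ) + 1) / 2)) *
        ∫⁻ a in Set.Ioi (0 : ℝ), ENNReal.ofReal (a ^ (((n : ℝ) - 1) / 2)) * f a := by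
  have h1 : ∫⁻ x : Fin (n + 1) → ℝ, f (x ⬝ᵥ x) =
      ∫⁻ x : EuclideanSpace ℝ (Fin (n + 1)), f (‖x‖ ^ 2) := by
    rw [← (PiLp.volume_preserving_ofLp (Fin (n + 1))).lintegral_comp (f := fun x => f (x ⬝ᵥ x))
      (hf.comp (by unfold dotProduct; fun_prop))]
    refine lintegral_congr fun x => ?_
    rw [EuclideanSpace.real_norm_sq_eq]
    simp [dotProduct, sq]
  rw [h1, lintegral_fun_norm_addHaar volume (f := fun r => f (r ^ 2)) (by fun_prop),
    lintegral_Ioi_eq_lintegral_comp_sqrt, EuclideanSpace.volume_ball]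
  simp only [finrank_euclideanSpace, Fintype.card_fin, Nat.add_sub_cancel, ENNReal.ofReal_one,
    one_pow, one_mul]
  have hn : (0 : ℝ) < ((n : ℝ) + 1) / 2 := by positivity
  have hΓ := Real.Gamma_pos_of_pos hn
  -- The sphere area, with the factor `2` set apart to cancel the `1 / 2` of the substitution.
  have hc : ((n + 1 : ℕ) : ℝ≥0∞) * ENNReal.ofReal (√Real.pi ^ (n + 1) /
      Real.Gamma (((n + 1 : ℕ) : ℝ) / 2 + 1)) =
      ENNReal.ofReal (Real.pi ^ (((n : ℝ) + 1) / 2) / Real.Gamma (((n : ℝ) + 1) / 2)) *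
        ENNReal.ofReal 2 := by
    rw [← ENNReal.ofReal_natCast, ← ENNReal.ofReal_mul (by positivity),
      ← ENNReal.ofReal_mul (by positivity)]
    congr 1
    push_cast
    rw [Real.Gamma_add_one hn.ne', Real.sqrt_eq_rpow, ← Real.rpow_natCast,
      ← Real.rpow_mul Real.pi_pos.le]
    push_cast
    rw [show (1 : ℝ) / 2 * ((n : ℝ) + 1) = ((n : ℝ) + 1) / 2 by ring]
    field_simp
  rw [hc, mul_assoc, ← lintegral_const_mul' _ _ ENNReal.ofReal_ne_top]
  congr 1
  refine setLIntegral_congr_fun measurableSet_Ioi fun a ha => ?_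
  have ha' : (0 : ℝ) < a := ha
  have hs := Real.sqrt_pos.2 ha'
  rw [Real.sq_sqrt ha'.le, ← mul_assoc, ← mul_assoc, ← ENNReal.ofReal_mul (by positivity),
    ← ENNReal.ofReal_mul (by positivity)]
  congr 2
  rw [sub_div, Real.rpow_sub ha', ← Real.sqrt_eq_rpow, Real.sqrt_eq_rpow, ← Real.rpow_natCast,
    ← Real.rpow_mul ha'.le, ← Real.sqrt_eq_rpow, show (1 : ℝ) / 2 * (n : ℝ) = (n : ℝ) / 2 by ring]
  field_simp

/-! ### Orthogonal invariance -/

/-- Two vectors of equal norm are exchanged by the reflection in the hyperplane orthogonal to their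
difference. If they coincide, the reflection is the identity, so `x = 0` needs no separate case. -/
theorem exists_measurePreserving_isometry {p : ℕ} (x : Fin (p + 1) → ℝ) :
    ∃ T : (Fin (p + 1) → ℝ) → Fin (p + 1) → ℝ, MeasurePreserving T volume volume ∧
      (∀ y z, T y ⬝ᵥ T z = y ⬝ᵥ z) ∧ T x = Fin.cons √(x ⬝ᵥ x) 0 := by
  let c : Fin (p + 1) → ℝ := Fin.cons √(x ⬝ᵥ x) 0
  let v : EuclideanSpace ℝ (Fin (p + 1)) := WithLp.toLp 2 x
  let w : EuclideanSpace ℝ (Fin (p + 1)) := WithLp.toLp 2 c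
  have hinner : ∀ y z : EuclideanSpace ℝ (Fin (p + 1)), inner ℝ y z = y.ofLp ⬝ᵥ z.ofLp := by
    intro y z
    simp [EuclideanSpace.inner_eq_star_dotProduct, dotProduct_comm]
  have hxx : 0 ≤ x ⬝ᵥ x := Finset.sum_nonneg fun i _ => mul_self_nonneg (x i)
  have hvw : ‖v‖ = ‖w‖ := by
    rw [← sq_eq_sq₀ (norm_nonneg _) (norm_nonneg _), ← real_inner_self_eq_norm_sq,
      ← real_inner_self_eq_norm_sq, hinner, hinner]
    simp [v, w, c, dotProduct, Fin.sum_univ_succ] at hxx ⊢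
    rw [Real.mul_self_sqrt hxx]
  let R := (Submodule.span ℝ {v - w})ᗮ.reflection
  refine ⟨fun y => (R (WithLp.toLp 2 y)).ofLp, ?_, fun y z => ?_, ?_⟩
  · exact (PiLp.volume_preserving_ofLp _).comp
      (R.measurePreserving.comp (PiLp.volume_preserving_toLp _))
  · rw [← hinner, R.inner_map_map, hinner]
  · change (R v).ofLp = c
    rw [show R v = w from Submodule.reflection_sub hvw]

/-- The integrand depends only on inner products, so all vectors may be moved by an isometry taking
`x` to the first axis; then `x` sees only the first coordinates `b`. -/
theorem lintegral_dotProduct_rowGram {p q : ℕ} (x : Fin (p + 1) → ℝ)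
    {F : (Fin q → ℝ) → Matrix (Fin q) (Fin q) ℝ → ℝ≥0∞} (hF : Measurable (Function.uncurry F)) :
    ∫⁻ Y : Fin q → Fin (p + 1) → ℝ, F (fun i => x ⬝ᵥ Y i) (rowGram Y) =
      ∫⁻ b : Fin q → ℝ, ∫⁻ Y : Fin q → Fin p → ℝ,
        F (√(x ⬝ᵥ x) • b) (Matrix.vecMulVec b b + rowGram Y) := by
  obtain ⟨T, hT, hTi, hTx⟩ := exists_measurePreserving_isometry x
  have hm : ∀ y : Fin (p + 1) → ℝ, Measurable fun Y : Fin q → Fin (p + 1) → ℝ =>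
      F (fun i => y ⬝ᵥ Y i) (rowGram Y) := fun y =>
    have hy : Measurable fun (Y : Fin q → Fin (p + 1) → ℝ) i => y ⬝ᵥ Y i := by
      simp only [dotProduct]
      fun_prop
    hF.comp (hy.prodMk measurable_rowGram)
  calc ∫⁻ Y : Fin q → Fin (p + 1) → ℝ, F (fun i => x ⬝ᵥ Y i) (rowGram Y)
      = ∫⁻ Y : Fin q → Fin (p + 1) → ℝ,
          F (fun i => T x ⬝ᵥ T (Y i)) (rowGram fun i => T (Y i)) := by
        simp only [rowGram, hTi]
    _ = ∫⁻ Y : Fin q → Fin (p + 1) → ℝ, F (fun i => T x ⬝ᵥ Y i) (rowGram Y) :=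
        (volume_preserving_pi fun _ : Fin q => hT).lintegral_comp (hm (T x))
    _ = _ := by
        rw [lintegral_rows_finCons (hm (T x))]
        simp only [rowGram_rows_cons, hTx]
        refine lintegral_congr fun b => lintegral_congr fun Y => ?_
        congr 1
        ext i
        simp [dotProduct, Fin.sum_univ_succ]

theorem lintegral_comp_smul_fin {q : ℕ} {F : (Fin q → ℝ) → ℝ≥0∞} (hF : Measurable F) {r : ℝ}
    (hr : 0 < r) :
    ∫⁻ b, F (r • b) = ENNReal.ofReal (r ^ (-(q : ℝ))) * ∫⁻ b, F b := by
  have h := Measure.map_addHaar_smul (volume : Measure (Fin q → ℝ)) hr.ne'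
  rw [← lintegral_map (μ := volume) hF (measurable_const_smul r), h, lintegral_smul_measure]
  simp [Real.rpow_neg hr.le, abs_of_pos (pow_pos hr q)]

/-! ### Integration over Gram matrices -/

theorem multiGamma_pos (q : ℕ) {a : ℝ} (ha : ((q : ℝ) - 1) / 2 < a) : 0 < multiGamma q a := by
  refine mul_pos (Real.rpow_pos_of_pos Real.pi_pos _) (Finset.prod_pos fun i _ => ?_)
  refine Real.Gamma_pos_of_pos ?_
  have : ((i : ℕ) : ℝ) + 1 ≤ q := by exact_mod_cast i.2
  linarith

theorem multiGamma_succ (q : ℕ) (a : ℝ) :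
    multiGamma (q + 1) a =
      Real.pi ^ ((q : ℝ) / 2) * Real.Gamma a * multiGamma q (a - 1 / 2) := by
  unfold multiGamma
  rw [Fin.prod_univ_succ]
  have h1 : ∀ i : Fin q,
      a - (((i.succ : Fin (q + 1)) : ℕ) : ℝ) / 2 = a - 1 / 2 - ((i : ℕ) : ℝ) / 2 := by
    intro i
    rw [Fin.val_succ]
    push_cast
    ring
  have h2 : (((q + 1 : ℕ) : ℝ) * (((q + 1 : ℕ) : ℝ) - 1) / 4) =
      (q : ℝ) / 2 + (q : ℝ) * ((q : ℝ) - 1) / 4 := by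
    push_cast
    ring
  simp only [h1, h2, Real.rpow_add Real.pi_pos]
  simp
  ring

/-- The constant `π^{pq/2} / Γ_q(p/2)`. -/
noncomputable def gramConst (p q : ℕ) : ℝ :=
  Real.pi ^ ((p : ℝ) * q / 2) / multiGamma q ((p : ℝ) / 2)

/-- The ratio is exactly the radial constant of `lintegral_dotProduct_self` in dimension `p + 1`. -/
theorem gramConst_succ (p q : ℕ) :
    gramConst (p + 1) (q + 1) =
      Real.pi ^ (((p : ℝ) + 1) / 2) / Real.Gamma (((p : ℝ) + 1) / 2) * gramConst p q := by
  unfold gramConst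
  rw [multiGamma_succ]
  have h1 : ((p + 1 : ℕ) : ℝ) * ((q + 1 : ℕ) : ℝ) / 2 =
      ((p : ℝ) + 1) / 2 + (p : ℝ) * q / 2 + (q : ℝ) / 2 := by
    push_cast
    ring
  have h2 : ((p + 1 : ℕ) : ℝ) / 2 - 1 / 2 = (p : ℝ) / 2 := by
    push_cast
    ring
  rw [h1, h2, Real.rpow_add Real.pi_pos, Real.rpow_add Real.pi_pos]
  have := (Real.rpow_pos_of_pos Real.pi_pos ((q : ℝ) / 2)).ne'
  push_cast
  field_simp

theorem gramConst_pos {p q : ℕ} (h : q ≤ p) : 0 < gramConst p q := by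
  refine div_pos (Real.rpow_pos_of_pos Real.pi_pos _) (multiGamma_pos q ?_)
  have : (q : ℝ) ≤ p := by exact_mod_cast h
  linarith

theorem measurable_vecMulVec_add {α : Type*} [MeasurableSpace α] {q : ℕ} {c : α → ℝ}
    {b : α → Fin q → ℝ} {C : α → Matrix (Fin q) (Fin q) ℝ} (hc : Measurable c) (hb : Measurable b)
    (hC : Measurable C) : Measurable fun x => c x • Matrix.vecMulVec (b x) (b x) + C x := by
  rw [measurable_matrix_iff] at hC ⊢
  intro i j
  simp only [Matrix.add_apply, Matrix.smul_apply, Matrix.vecMulVec_apply, smul_eq_mul]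
  have := hC i j
  fun_prop

/-- Adding a rank-one symmetric matrix is a translation of the upper entries, hence preserves
Lebesgue measure. -/
theorem symmOfUpper_add_vecMulVec {q : ℕ} (c : ℝ) (b : Fin q → ℝ) (v : UpperIndex q → ℝ) :
    symmOfUpper q (v + fun ij => c * (b ij.1.1 * b ij.1.2)) =
      c • Matrix.vecMulVec b b + symmOfUpper q v := by
  ext i j
  rcases le_total i j with h | h <;>
    simp [symmOfUpper, h, Matrix.vecMulVec_apply] <;> ring

/-- Change of variables from the Schur complement to the block itself, at fixed corner `a`.
Replacing `√a b` by `b` costs `a^{-q/2}`, the block is translated by `a⁻¹ b bᵀ`, and the remaining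
`a^e` is the corner's share of the determinant power. -/
theorem lintegral_detPow_bordered {q : ℕ} {e a : ℝ} (ha : 0 < a)
    {g : Matrix (Fin (q + 1)) (Fin (q + 1)) ℝ → ℝ≥0∞} (hg : Measurable g) :
    ENNReal.ofReal (a ^ (e + (q : ℝ) / 2)) * ∫⁻ b, ∫⁻ v, detPow q e (symmOfUpper q v) *
        g (bordered a (√a • b) (Matrix.vecMulVec b b + symmOfUpper q v)) =
      ∫⁻ b, ∫⁻ v, detPow (q + 1) e (bordered a b (symmOfUpper q v)) *
        g (bordered a b (symmOfUpper q v)) := by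
  have hs := measurable_symmOfUpper q
  let F : (Fin q → ℝ) → ℝ≥0∞ := fun b => ∫⁻ v, detPow q e (symmOfUpper q v) *
    g (bordered a b (a⁻¹ • Matrix.vecMulVec b b + symmOfUpper q v))
  have hF : Measurable F := by
    refine Measurable.lintegral_prod_right' (f := fun w : (Fin q → ℝ) × (UpperIndex q → ℝ) =>
      detPow q e (symmOfUpper q w.2) *
        g (bordered a w.1 (a⁻¹ • Matrix.vecMulVec w.1 w.1 + symmOfUpper q w.2))) ?_
    have h2 : Measurable fun w : (Fin q → ℝ) × (UpperIndex q → ℝ) => symmOfUpper q w.2 :=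
      hs.comp measurable_snd
    exact ((measurable_detPow q e).comp h2).mul (hg.comp (measurable_bordered measurable_const
      measurable_fst (measurable_vecMulVec_add measurable_const measurable_fst h2)))
  have hsa := Real.sqrt_pos.2 ha
  have h1 : ∀ b : Fin q → ℝ, ∫⁻ v, detPow q e (symmOfUpper q v) *
      g (bordered a (√a • b) (Matrix.vecMulVec b b + symmOfUpper q v)) = F (√a • b) := by
    intro b
    simp only [F, Matrix.smul_vecMulVec, Matrix.vecMulVec_smul, smul_smul]
    rw [Real.mul_self_sqrt ha.le, inv_mul_cancel₀ ha.ne', one_smul]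
  have h2 : ∀ b : Fin q → ℝ, F b = ∫⁻ v,
      detPow q e (symmOfUpper q v - a⁻¹ • Matrix.vecMulVec b b) *
        g (bordered a b (symmOfUpper q v)) := by
    intro b
    rw [← lintegral_add_right_eq_self _ fun ij : UpperIndex q => a⁻¹ * (b ij.1.1 * b ij.1.2)]
    simp only [symmOfUpper_add_vecMulVec, add_sub_cancel_left, F]
  have h3 : ∀ b : Fin q → ℝ, ∫⁻ v, detPow (q + 1) e (bordered a b (symmOfUpper q v)) *
      g (bordered a b (symmOfUpper q v)) = ENNReal.ofReal (a ^ e) * F b := by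
    intro b
    rw [h2, ← lintegral_const_mul' _ _ ENNReal.ofReal_ne_top]
    simp only [detPow_bordered e ha, mul_assoc]
  simp only [h1, h3]
  rw [lintegral_comp_smul_fin hF hsa, lintegral_const_mul' _ _ ENNReal.ofReal_ne_top, ← mul_assoc,
    ← ENNReal.ofReal_mul (by positivity)]
  congr 2
  rw [Real.sqrt_eq_rpow, ← Real.rpow_mul ha.le, ← Real.rpow_add ha]
  congr 1
  ring

theorem lintegral_rowGram (q : ℕ) : ∀ p : ℕ, q ≤ p →
    ∀ {g : Matrix (Fin q) (Fin q) ℝ → ℝ≥0∞}, Measurable g →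
    ∫⁻ Z : Fin q → Fin p → ℝ, g (rowGram Z) =
      ENNReal.ofReal (gramConst p q) * ∫⁻ v, detPow q (((p : ℝ) - q - 1) / 2) (symmOfUpper q v) *
        g (symmOfUpper q v) := by
  induction q with
  | zero =>
    intro p _ g _
    have hM : ∀ M : Matrix (Fin 0) (Fin 0) ℝ, M = 1 := fun M => Subsingleton.elim _ _
    have h1 : ∀ Z : Fin 0 → Fin p → ℝ, g (rowGram Z) = g 1 := fun Z => by rw [hM (rowGram Z)]
    have h2 : ∀ v, detPow 0 (((p : ℝ) - (0 : ℕ) - 1) / 2) (symmOfUpper 0 v) *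
        g (symmOfUpper 0 v) = g 1 := fun v => by
      rw [hM (symmOfUpper 0 v)]
      simp [detPow, Matrix.PosDef.one]
    simp only [h1, h2]
    rw [lintegral_const, lintegral_const, Measure.volume_pi_eq_dirac 0, Measure.volume_pi_eq_dirac 0]
    simp [gramConst, multiGamma]
  | succ q ih =>
    intro p hp g hg
    obtain ⟨p, rfl⟩ : ∃ p', p = p' + 1 := ⟨p - 1, by omega⟩
    have hqp : q ≤ p := by omega
    have hs := measurable_symmOfUpper q
    -- The exponent depends only on `p - q`, so it is unchanged when a vector and a dimension are
    -- removed together.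
    have he : (((p + 1 : ℕ) : ℝ) - ((q + 1 : ℕ) : ℝ) - 1) / 2 = ((p : ℝ) - q - 1) / 2 := by
      push_cast
      ring
    rw [he]
    set e := ((p : ℝ) - q - 1) / 2
    let H : ℝ → ℝ≥0∞ := fun a => ∫⁻ b, ∫⁻ v, detPow q e (symmOfUpper q v) *
        g (bordered a (√a • b) (Matrix.vecMulVec b b + symmOfUpper q v))
    have hH : Measurable H := by
      refine Measurable.lintegral_prod_right' (f := fun w : ℝ × (Fin q → ℝ) =>
        ∫⁻ v, detPow q e (symmOfUpper q v) *
          g (bordered w.1 (√w.1 • w.2) (Matrix.vecMulVec w.2 w.2 + symmOfUpper q v))) ?_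
      refine Measurable.lintegral_prod_right' (f := fun w : (ℝ × (Fin q → ℝ)) × (UpperIndex q → ℝ) =>
        detPow q e (symmOfUpper q w.2) * g (bordered w.1.1 (√w.1.1 • w.1.2)
          (Matrix.vecMulVec w.1.2 w.1.2 + symmOfUpper q w.2))) ?_
      have h2 : Measurable fun w : (ℝ × (Fin q → ℝ)) × (UpperIndex q → ℝ) => symmOfUpper q w.2 :=
        hs.comp measurable_snd
      refine ((measurable_detPow q e).comp h2).mul (hg.comp (measurable_bordered
        (by fun_prop) (by fun_prop) ?_))
      simpa using measurable_vecMulVec_add (c := fun _ => (1 : ℝ)) measurable_const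
        (b := fun w : (ℝ × (Fin q → ℝ)) × (UpperIndex q → ℝ) => w.1.2) (by fun_prop) h2
    have inner : ∀ x : Fin (p + 1) → ℝ,
        ∫⁻ Y : Fin q → Fin (p + 1) → ℝ, g (rowGram (Fin.cons x Y : Fin (q + 1) → _)) =
          ENNReal.ofReal (gramConst p q) * H (x ⬝ᵥ x) := by
      intro x
      simp only [rowGram_cons]
      rw [lintegral_dotProduct_rowGram x (F := fun b C => g (bordered (x ⬝ᵥ x) b C))
        (hg.comp (measurable_bordered measurable_const measurable_fst measurable_snd)),
        ← lintegral_const_mul' _ _ ENNReal.ofReal_ne_top]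
      refine lintegral_congr fun b => ?_
      refine ih p hqp (g := fun C => g (bordered (x ⬝ᵥ x) (√(x ⬝ᵥ x) • b)
        (Matrix.vecMulVec b b + C))) ?_
      refine hg.comp (measurable_bordered measurable_const measurable_const ?_)
      simpa using measurable_vecMulVec_add (c := fun _ => (1 : ℝ)) measurable_const
        (b := fun _ : Matrix (Fin q) (Fin q) ℝ => b) measurable_const measurable_id
    have hw : Measurable fun S => detPow (q + 1) e S * g S := (measurable_detPow _ _).mul hg
    have outer : ∫⁻ v, detPow (q + 1) e (symmOfUpper (q + 1) v) * g (symmOfUpper (q + 1) v) =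
        ∫⁻ a in Set.Ioi (0 : ℝ), ENNReal.ofReal (a ^ (((p : ℝ) - 1) / 2)) * H a := by
      rw [lintegral_symmOfUpper_succ hw, ← lintegral_indicator measurableSet_Ioi]
      refine lintegral_congr fun a => ?_
      by_cases ha : 0 < a
      · rw [Set.indicator_of_mem (Set.mem_Ioi.2 ha), ← lintegral_detPow_bordered ha hg]
        -- The radial exponent matches: `e + q/2 = (p-1)/2`.
        congr 4
        simp only [e]
        ring
      · rw [Set.indicator_of_notMem (by simpa using ha)]
        simp [detPow_bordered_of_nonpos e (not_lt.1 ha)]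
    rw [lintegral_finCons (F := fun Z => g (rowGram Z)) (hg.comp measurable_rowGram)]
    simp only [inner]
    rw [lintegral_const_mul' _ _ ENNReal.ofReal_ne_top, lintegral_dotProduct_self p hH, outer,
      gramConst_succ, mul_comm (_ / _), ENNReal.ofReal_mul (gramConst_pos hqp).le, mul_assoc]

/-! ### Linear changes of variables -/

theorem lintegral_comp_pi {E : Type*} [MeasureSpace E] [SigmaFinite (volume : Measure E)]
    {T : E → E} (hT : Measurable T) {c : ℝ≥0∞} (hc : c ≠ ∞)
    (h : Measure.map T volume = c • volume) (n : ℕ) :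
    ∀ {F : (Fin n → E) → ℝ≥0∞}, Measurable F →
      ∫⁻ Z : Fin n → E, F (fun j => T (Z j)) = c ^ n * ∫⁻ Z, F Z := by
  induction n with
  | zero =>
    intro F _
    rw [Measure.volume_pi_eq_dirac Fin.elim0]
    simp only [lintegral_dirac, pow_zero, one_mul]
    congr 1
    exact Subsingleton.elim _ _
  | succ n ih =>
    intro F hF
    have hcons : Measurable fun w : E × (Fin n → E) => (Fin.cons w.1 w.2 : Fin (n + 1) → E) := by
      simp only [← piFinSuccAbove_zero_symm_apply]
      exact MeasurableEquiv.measurable _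
    have hTn : Measurable fun (Z : Fin (n + 1) → E) j => T (Z j) :=
      measurable_pi_lambda _ fun j => hT.comp (measurable_pi_apply j)
    have h1 : ∀ (x : E) (Y : Fin n → E),
        (fun j => T ((Fin.cons x Y : Fin (n + 1) → E) j)) = Fin.cons (T x) fun j => T (Y j) := by
      intro x Y
      ext j
      refine Fin.cases rfl (fun j => rfl) j
    have hG : Measurable fun x : E => ∫⁻ Y : Fin n → E, F (Fin.cons x Y) :=
      (hF.comp hcons).lintegral_prod_right'
    have h2 : ∀ x : E, ∫⁻ Y : Fin n → E, F (Fin.cons x fun j => T (Y j)) =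
        c ^ n * ∫⁻ Y : Fin n → E, F (Fin.cons x Y) := fun x =>
      ih (F := fun Y => F (Fin.cons x Y)) (hF.comp (hcons.comp measurable_prodMk_left))
    rw [lintegral_finCons (F := fun Z => F fun j => T (Z j)) (hF.comp hTn)]
    simp only [h1, h2]
    rw [lintegral_const_mul' _ _ (ENNReal.pow_ne_top hc),
      ← lintegral_map (μ := volume) (f := fun x => ∫⁻ Y : Fin n → E, F (Fin.cons x Y)) hG hT, h,
      lintegral_smul_measure, ← lintegral_finCons hF, smul_eq_mul, pow_succ, mul_assoc]

/-- Induction on the number of columns: splitting off the first column on one side corresponds to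
splitting off the first row on the other. -/
theorem lintegral_transpose (p q : ℕ) : ∀ {F : (Fin p → Fin q → ℝ) → ℝ≥0∞}, Measurable F →
    ∫⁻ X, F X = ∫⁻ Z : Fin q → Fin p → ℝ, F fun i j => Z j i := by
  induction q with
  | zero =>
    intro F _
    have h1 : ∀ X, F X = F fun _ => Fin.elim0 := fun X => by congr 1; ext i j; exact j.elim0
    have h2 : ∀ Z : Fin 0 → Fin p → ℝ, F (fun i j => Z j i) = F fun _ => Fin.elim0 :=
      fun Z => h1 _
    simp only [h1]
    rw [lintegral_const, lintegral_const]
    simp [volume_pi, Measure.pi_univ]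
  | succ q ih =>
    intro F hF
    have ht : Measurable fun (Z : Fin (q + 1) → Fin p → ℝ) i j => Z j i := by fun_prop
    rw [lintegral_rows_finCons hF,
      lintegral_finCons (F := fun Z : Fin (q + 1) → Fin p → ℝ => F fun i j => Z j i) (hF.comp ht)]
    refine lintegral_congr fun b => ?_
    have hb : Measurable fun (X : Fin p → Fin q → ℝ) i =>
        (Fin.cons (b i) (X i) : Fin (q + 1) → ℝ) := by
      refine measurable_pi_lambda _ fun i => measurable_pi_lambda _ fun j => ?_
      refine Fin.cases ?_ (fun j => ?_) j
      · exact measurable_const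
      · simp only [Fin.cons_succ]
        fun_prop
    rw [ih (F := fun X => F fun i => Fin.cons (b i) (X i)) (hF.comp hb)]
    refine lintegral_congr fun Y => ?_
    congr 1
    ext i j
    refine Fin.cases rfl (fun j => rfl) j

theorem gram_eq_rowGram {p q : ℕ} {U V : Matrix (Fin p) (Fin p) ℝ} (hV : U⁻¹ = Vᵀ * V)
    (Z : Fin q → Fin p → ℝ) :
    gram U (fun i j => Z j i : Matrix (Fin p) (Fin q) ℝ) = rowGram fun j => V.toLin' (Z j) := by
  let X : Matrix (Fin p) (Fin q) ℝ := fun i j => Z j i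
  have h : gram U X = (V * X)ᵀ * (V * X) := by
    rw [gram, hV, Matrix.transpose_mul]
    simp only [Matrix.mul_assoc]
  change gram U X = _
  rw [h]
  rfl

theorem measurable_gram {p q : ℕ} (U : Matrix (Fin p) (Fin p) ℝ) :
    Measurable (gram (q := q) U) := by
  rw [measurable_matrix_iff]
  intro i j
  simp only [gram, Matrix.mul_apply, Matrix.transpose_apply]
  have := fun i j => measurable_entry (m := Fin p) (n := Fin q) i j
  fun_prop

/-- With `U⁻¹ = Vᵀ V`, the matrix `Xᵀ U⁻¹ X` is the Gram matrix of the columns of `V X`. Each of the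
`q` columns contributes the Jacobian `|det V|⁻¹ = √(det U)`. -/
theorem lintegral_gram {p q : ℕ} (hpq : q ≤ p) {U : Matrix (Fin p) (Fin p) ℝ} (hU : U.PosDef)
    {g : Matrix (Fin q) (Fin q) ℝ → ℝ≥0∞} (hg : Measurable g) :
    ∫⁻ X, g (gram U X) ∂lebMatrix p q =
      ENNReal.ofReal (U.det ^ ((q : ℝ) / 2) * gramConst p q) *
        ∫⁻ v, detPow q (((p : ℝ) - q - 1) / 2) (symmOfUpper q v) * g (symmOfUpper q v) := by
  obtain ⟨V, hV⟩ : ∃ V : Matrix (Fin p) (Fin p) ℝ, U⁻¹ = Vᵀ * V := by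
    open scoped MatrixOrder in
    obtain ⟨V, hV⟩ := CStarAlgebra.nonneg_iff_eq_star_mul_self.mp hU.inv.posSemidef.nonneg
    exact ⟨V, by simpa [Matrix.star_eq_conjTranspose] using hV⟩
  have hdet : U.det * (V.det * V.det) = 1 := by
    have h := congrArg Matrix.det hV
    rw [Matrix.det_mul, Matrix.det_transpose] at h
    rw [← h, ← Matrix.det_mul, Matrix.mul_nonsing_inv _ hU.det_pos.ne'.isUnit, Matrix.det_one]
  have hV0 : V.det ≠ 0 := fun h => by simp [h] at hdet
  have habs : |V.det⁻¹| = √U.det := by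
    rw [eq_comm, Real.sqrt_eq_iff_mul_self_eq hU.det_pos.le (abs_nonneg _), abs_mul_abs_self]
    field_simp
    linarith
  have hrow : Measurable fun Z : Fin q → Fin p → ℝ => g (rowGram Z) := hg.comp measurable_rowGram
  have hT : Measurable V.toLin' := by
    refine measurable_pi_lambda _ fun i => ?_
    simp only [Matrix.toLin'_apply, Matrix.mulVec, dotProduct]
    fun_prop
  calc ∫⁻ X, g (gram U X) ∂lebMatrix p q
      = ∫⁻ Z : Fin q → Fin p → ℝ, g (gram U (fun i j => Z j i : Matrix (Fin p) (Fin q) ℝ)) :=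
        lintegral_transpose p q (hg.comp (measurable_gram U))
    _ = ∫⁻ Z : Fin q → Fin p → ℝ, g (rowGram fun j => V.toLin' (Z j)) := by
        simp only [gram_eq_rowGram hV]
    _ = ENNReal.ofReal |V.det⁻¹| ^ q * ∫⁻ Z : Fin q → Fin p → ℝ, g (rowGram Z) :=
        lintegral_comp_pi hT ENNReal.ofReal_ne_top
          (Real.map_matrix_volume_pi_eq_smul_volume_pi hV0) q hrow
    _ = _ := by
        rw [lintegral_rowGram q p hpq hg, ← mul_assoc, habs, ← ENNReal.ofReal_pow (by positivity),
          ← ENNReal.ofReal_mul (by positivity), Real.sqrt_eq_rpow, ← Real.rpow_natCast,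
          ← Real.rpow_mul hU.det_pos.le]
        congr 4
        ring

/-- An extension by zero allows integration over all upper entries, including those outside the
image of the cone. -/
theorem lintegral_lebPosDef {q : ℕ} {h : PosDefMatrix q → ℝ≥0∞}
    {G : Matrix (Fin q) (Fin q) ℝ → ℝ≥0∞} (hG : ∀ S : PosDefMatrix q, G S.1 = h S)
    (hG0 : ∀ S, ¬ S.PosDef → G S = 0) :
    ∫⁻ S, h S ∂lebPosDef q = ∫⁻ v, G (symmOfUpper q v) := by
  have he := measurableEmbedding_upperCoords q
  have h1 : ∀ S : PosDefMatrix q, h S = G (symmOfUpper q (upperCoords q S)) := fun S => by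
    rw [symmOfUpper_upperCoords, hG]
  simp only [h1]
  rw [lebPosDef, ← he.lintegral_map (fun v => G (symmOfUpper q v)), he.map_comap,
    ← lintegral_indicator he.measurableSet_range]
  refine lintegral_congr fun v => ?_
  by_cases hv : v ∈ Set.range (upperCoords q)
  · rw [Set.indicator_of_mem hv]
  · rw [Set.indicator_of_notMem hv, hG0]
    intro hS
    refine hv ⟨⟨_, hS⟩, ?_⟩
    ext ⟨⟨i, j⟩, hij⟩
    have hij' : i ≤ j := hij
    simp [upperCoords, symmOfUpper, hij']

/-! ### The law of the Gram matrix -/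

open scoped Classical in
/-- Extension by zero of a function on positive definite matrices to all matrices. -/
noncomputable def extendZero {q : ℕ} (h : PosDefMatrix q → ℝ≥0∞) (S : Matrix (Fin q) (Fin q) ℝ) :
    ℝ≥0∞ :=
  if hS : S.PosDef then h ⟨S, hS⟩ else 0

theorem measurable_extendZero {q : ℕ} {h : PosDefMatrix q → ℝ≥0∞} (hh : Measurable h) :
    Measurable (extendZero h) := by
  classical
  exact Measurable.dite (s := {S : Matrix (Fin q) (Fin q) ℝ | S.PosDef}) (f := h) hh measurable_const
    (measurableSet_posDef q)

theorem measurable_upcastDensity {p q : ℕ} (U : Matrix (Fin p) (Fin p) ℝ)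
    {f : PosDefMatrix q → ℝ≥0∞} (hf : Measurable f) : Measurable (upcastDensity U f) :=
  (measurable_extendZero hf).comp (measurable_gram U)

/-- The pushforward identity against test functions: `h = 1` gives the total mass, indicators give
the law. -/
theorem lintegral_upcastLaw {p q : ℕ} (hpq : q ≤ p) {U : Matrix (Fin p) (Fin p) ℝ}
    (hU : U.PosDef) {f h : PosDefMatrix q → ℝ≥0∞} (hf : Measurable f) (hh : Measurable h) :
    ∫⁻ X, upcastDensity U h X ∂upcastLaw U f = ∫⁻ S, h S ∂targetLaw f := by
  let c : Matrix (Fin q) (Fin q) ℝ → ℝ≥0∞ := fun S => ENNReal.ofReal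
    (multiGamma q ((p : ℝ) / 2) / Real.pi ^ ((p : ℝ) * (q : ℝ) / 2) *
      (U.det ^ (-(q : ℝ) / 2) / S.det ^ ((p : ℝ) / 2)))
  have hc : Measurable c := by
    have := measurable_det q
    fun_prop
  let G : Matrix (Fin q) (Fin q) ℝ → ℝ≥0∞ := fun S => c S * (extendZero f S * extendZero h S)
  have hG : Measurable G := hc.mul ((measurable_extendZero hf).mul (measurable_extendZero hh))
  have hd : Measurable fun S : PosDefMatrix q =>
      ENNReal.ofReal (S.1.det ^ (-((q : ℝ) + 1) / 2)) :=
    (((measurable_det q).comp measurable_subtype_coe).pow_const _).ennreal_ofReal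
  have hUf := measurable_upcastDensity U hf
  have hUh := measurable_upcastDensity U hh
  have lhs : ∫⁻ X, upcastDensity U h X ∂upcastLaw U f = ∫⁻ X, G (gram U X) ∂lebMatrix p q := by
    have hnu : nu q U = (lebMatrix p q).withDensity (c ∘ gram U) := rfl
    rw [upcastLaw, lintegral_withDensity_eq_lintegral_mul _ hUf hUh, hnu,
      lintegral_withDensity_eq_lintegral_mul _ (hc.comp (measurable_gram U)) (hUf.mul hUh)]
    rfl
  have rhs : ∫⁻ S, h S ∂targetLaw f =
      ∫⁻ S : PosDefMatrix q, ENNReal.ofReal (S.1.det ^ (-((q : ℝ) + 1) / 2)) * (f S * h S)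
        ∂lebPosDef q := by
    rw [targetLaw, lintegral_withDensity_eq_lintegral_mul _ hf hh, mu,
      lintegral_withDensity_eq_lintegral_mul _ hd (hf.mul hh)]
    rfl
  rw [lhs, rhs, lintegral_gram hpq hU hG, ← lintegral_const_mul' _ _ ENNReal.ofReal_ne_top]
  symm
  refine lintegral_lebPosDef (G := fun S =>
    ENNReal.ofReal (U.det ^ ((q : ℝ) / 2) * gramConst p q) *
      (detPow q (((p : ℝ) - q - 1) / 2) S * G S)) (fun S => ?_) (fun S hS => ?_)
  · have hS := S.2.det_pos
    have hk := gramConst_pos hpq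
    -- The normalization of `ν_U` is the inverse of the Gram constant and Jacobian, and `(p-q-1)/2 -
    -- p/2 = -(q+1)/2`.
    have hc0 : U.det ^ ((q : ℝ) / 2) * gramConst p q * (S.1.det ^ (((p : ℝ) - q - 1) / 2) *
        (multiGamma q ((p : ℝ) / 2) / Real.pi ^ ((p : ℝ) * (q : ℝ) / 2) *
          (U.det ^ (-(q : ℝ) / 2) / S.1.det ^ ((p : ℝ) / 2)))) =
        S.1.det ^ (-((q : ℝ) + 1) / 2) := by
      have e1 : multiGamma q ((p : ℝ) / 2) / Real.pi ^ ((p : ℝ) * (q : ℝ) / 2) =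
          (gramConst p q)⁻¹ := by rw [gramConst, inv_div]
      have e2 : -((q : ℝ) + 1) / 2 = ((p : ℝ) - q - 1) / 2 - (p : ℝ) / 2 := by ring
      have hUq := Real.rpow_pos_of_pos hU.det_pos ((q : ℝ) / 2)
      rw [e1, e2, Real.rpow_sub hS, neg_div, Real.rpow_neg hU.det_pos.le]
      field_simp
    have hk' : 0 ≤ U.det ^ ((q : ℝ) / 2) * gramConst p q :=
      mul_nonneg (Real.rpow_nonneg hU.det_pos.le _) hk.le
    have hp' := Real.rpow_nonneg hS.le (((p : ℝ) - q - 1) / 2)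
    simp only [G, c, detPow, extendZero, S.2, if_true, dif_pos]
    rw [← hc0, ENNReal.ofReal_mul hk', ENNReal.ofReal_mul hp']
    simp only [mul_assoc]
  · simp [detPow, hS]

/-- Immediate from the density being `0` elsewhere; no statement about Lebesgue null sets is
required. -/
theorem ae_posDef_gram_upcastLaw {p q : ℕ} (U : Matrix (Fin p) (Fin p) ℝ)
    {f : PosDefMatrix q → ℝ≥0∞} (hf : Measurable f) :
    ∀ᵐ X ∂upcastLaw U f, (gram U X).PosDef := by
  rw [upcastLaw, ae_withDensity_iff (measurable_upcastDensity U hf)]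
  refine ae_of_all _ fun X hX => ?_
  by_contra h
  exact hX (dif_neg h)

theorem upcastLaw_univ {p q : ℕ} (hpq : q ≤ p) {U : Matrix (Fin p) (Fin p) ℝ}
    (hU : U.PosDef) {f : PosDefMatrix q → ℝ≥0∞} (hf : Measurable f) :
    upcastLaw U f Set.univ = targetLaw f Set.univ := by
  have h := lintegral_upcastLaw hpq hU hf (h := fun _ => 1) measurable_const
  rw [lintegral_one] at h
  rw [← h, ← lintegral_one]
  refine lintegral_congr_ae ?_
  filter_upwards [ae_posDef_gram_upcastLaw U hf] with X hX
  simp [upcastDensity, hX]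

open scoped Classical in
/-- The map `x ↦ xᵀ U⁻¹ x` into `P⁺(q)`, with value `1` where `xᵀ U⁻¹ x` is not positive
definite. -/
noncomputable def gramPosDef {p q : ℕ} (U : Matrix (Fin p) (Fin p) ℝ)
    (X : Matrix (Fin p) (Fin q) ℝ) : PosDefMatrix q :=
  if h : (gram U X).PosDef then ⟨gram U X, h⟩ else ⟨1, Matrix.PosDef.one⟩

theorem measurable_gramPosDef {p q : ℕ} (U : Matrix (Fin p) (Fin p) ℝ) :
    Measurable (gramPosDef (q := q) U) := by
  classical
  exact Measurable.dite (s := {X : Matrix (Fin p) (Fin q) ℝ | (gram U X).PosDef})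
    (f := fun X => (⟨gram U X.1, X.2⟩ : PosDefMatrix q))
    ((measurable_gram U).comp measurable_subtype_coe).subtype_mk measurable_const
    (measurable_gram U (measurableSet_posDef q))

theorem hasLaw_gramPosDef {p q : ℕ} (hpq : q ≤ p) {U : Matrix (Fin p) (Fin p) ℝ}
    (hU : U.PosDef) {f : PosDefMatrix q → ℝ≥0∞} (hf : Measurable f) :
    HasLaw (gramPosDef U) (targetLaw f) (upcastLaw U f) where
  aemeasurable := (measurable_gramPosDef U).aemeasurable
  map_eq := by
    ext A hA
    have hm : Measurable (A.indicator (1 : PosDefMatrix q → ℝ≥0∞)) := measurable_one.indicator hA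
    rw [← lintegral_indicator_one hA, ← lintegral_indicator_one hA,
      lintegral_map hm (measurable_gramPosDef U), ← lintegral_upcastLaw hpq hU hf hm]
    refine lintegral_congr_ae ?_
    filter_upwards [ae_posDef_gram_upcastLaw U hf] with X hX
    simp [upcastDensity, gramPosDef, hX]

end Upcast

theorem mainTheorem1 {p q : ℕ} (hpq : q ≤ p)
    (U : Matrix (Fin p) (Fin p) ℝ) (hU : U.PosDef)
    (f : Upcast.PosDefMatrix q → ℝ≥0∞) (hf : Measurable f)
    (hprob : IsProbabilityMeasure (Upcast.targetLaw f)) :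
    IsProbabilityMeasure (Upcast.upcastLaw U f) ∧
    ∀ (Ω : Type*) [MeasurableSpace Ω] (P : Measure Ω) [IsProbabilityMeasure P]
      (X : Ω → Matrix (Fin p) (Fin q) ℝ), HasLaw X (Upcast.upcastLaw U f) P →
      (∀ᵐ ω ∂P, ((X ω)ᵀ * U⁻¹ * X ω).PosDef) ∧
      ∀ S : Ω → Upcast.PosDefMatrix q,
        (∀ᵐ ω ∂P, (S ω : Matrix (Fin q) (Fin q) ℝ) = (X ω)ᵀ * U⁻¹ * X ω) →
        HasLaw S (Upcast.targetLaw f) P := by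
  refine ⟨⟨(Upcast.upcastLaw_univ hpq hU hf).trans hprob.measure_univ⟩, ?_⟩
  intro Ω _ P _ X hX
  have hpos : ∀ᵐ ω ∂P, (Upcast.gram U (X ω)).PosDef :=
    ae_of_ae_map hX.aemeasurable (hX.map_eq ▸ Upcast.ae_posDef_gram_upcastLaw U hf)
  refine ⟨hpos, fun S hS => ?_⟩
  -- `S` is not assumed measurable: its a.e. measurability also comes from a.s. equality with
  -- `gramPosDef U ∘ X`.
  refine ((Upcast.hasLaw_gramPosDef hpq hU hf).comp hX).congr ?_
  filter_upwards [hpos, hS] with ω h1 h2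
  refine Subtype.ext ?_
  simp only [Function.comp_apply, Upcast.gramPosDef, dif_pos h1, h2]
  rfl
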